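/- Let $\mathcal H$ be a separable complex Hilbert space (inner product linear in the second factor), and let $S$ be a densely defined, closed linear operator in $\mathcal H$ such that, for some $\varepsilon>0$, $(u,Su)_{\mathcal H}\ge\varepsilon\|u\|_{\mathcal H}^2$ for all $u\in\operatorname{dom}(S)$ (that is, $S\ge\varepsilon I_{\mathcal H}$; in particular $S$ is symmetric). Suppose that $S$ has deficiency indices $(r,r)$, $\dim\ker(S^*\mp iI_{\mathcal H})=r$, with $r\in\{1,2,3,\dots\}\cup\{\infty\}$. Let $S_F$ and $S_K$ be the Friedrichs and the Krein–von Neumann extension of $S$, that is, the restrictions of $S^*$ to $$\operatorname{dom}(S_F)=\Big\{v\in\operatorname{dom}(S^*) : \exists\, (v_j)_{j}\subset\operatorname{dom}(S),\ \|v_j-v\|\to0,\ (v_j-v_k,S(v_j-v_k))\to0 \text{ as } j,k\to\infty\Big\},$$ $$\operatorname{dom}(S_K)=\Big\{v\in\operatorname{dom}(S^*) : \exists\, (v_j)_{j}\subset\operatorname{dom}(S),\ \|Sv_j-S^*v\|\to0,\ (v_j-v_k,S(v_j-v_k))\to0 \text{ as } j,k\to\infty\Big\}.$$ Let $P_{\ker(S_K)}$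 be the orthogonal projection onto $\ker(S_K)$, let $\widehat{\mathcal H}=[\ker(S_K)]^{\perp}=[I_{\mathcal H}-P_{\ker(S_K)}]\mathcal H$, and let $\widehat S_K=S_K|_{[\ker(S_K)]^\perp}$, with domain $\operatorname{dom}(S_K)\cap\widehat{\mathcal H}$, be the reduced Krein–von Neumann operator in $\widehat{\mathcal H}$. For $p\in(0,\infty)$ let $\mathcal B_p$ denote the trace ideal of compact operators whose sequence of singular values lies in $\ell^p$, and let $\mathcal B_\infty$ denote the compact operators. Then $\ker(S_K)=\ker(S^*)$, the operators $S_F$ and $\widehat S_K$ have bounded, everywhere defined inverses on $\mathcal H$ and $\widehat{\mathcal H}$, respectively, and $(S_F)^{-1}\ge0$; denote by $(S_F)^{-1/2}$ its non-negative square root. For every $p\in(0,\infty]$ the following are equivalent: (i) $(\widehat S_K)^{-1}\in\mathcal B_p(\widehat{\mathcal H})$; (ii) $[I_{\mathcal H}-P_{\ker(S_K)}](S_F)^{-1}[I_{\mathcal H}-P_{\ker(S_K)}]\in\mathcal B_p(\mathcal H)$; (iii) $[I_{\mathcal H}-P_{\ker(S_K)}](S_F)^{-1/2}\in\mathcal B_{2p}(\mathcal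 H)$; (iv) $(S_F)^{-1/2}[I_{\mathcal H}-P_{\ker(S_K)}]\in\mathcal B_{2p}(\mathcal H)$. In particular, $(S_F)^{-1}\in\mathcal B_p(\mathcal H)$ implies $(\widehat S_K)^{-1}\in\mathcal B_p(\widehat{\mathcal H})$. -/

import Mathlib

open Filter Topology
open scoped ENNReal

namespace KreinVN

noncomputable section

variable {H : Type*} [NormedAddCommGroup H] [InnerProductSpace ℂ H]

/-- `T ≥ c I` for a possibly unbounded operator `T`: the number `(x, T x)` is real and
at least `c ‖x‖ ^ 2` for every `x` in the domain of `T`. -/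
def OpGe (T : H →ₗ.[ℂ] H) (c : ℝ) : Prop :=
  ∀ x : T.domain, c * ‖(x : H)‖ ^ 2 ≤ (inner ℂ (x : H) (T x)).re ∧ (inner ℂ (x : H) (T x)).im = 0

/-- `T` is non-negative: `(x, T x) ≥ 0` for every `x` in the domain of `T`. -/
def Nonneg (T : H →ₗ.[ℂ] H) : Prop :=
  ∀ x : T.domain, 0 ≤ (inner ℂ (x : H) (T x)).re ∧ (inner ℂ (x : H) (T x)).im = 0

theorem OpGe.nonneg {T : H →ₗ.[ℂ] H} {c : ℝ} (h : OpGe T c) (hc : 0 ≤ c) : Nonneg T :=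
  fun x => ⟨le_trans (by positivity) (h x).1, (h x).2⟩

/-- The kernel of `T - z I`, as a subspace of the whole space. -/
def kerSub (T : H →ₗ.[ℂ] H) (z : ℂ) : Submodule ℂ H :=
  (LinearMap.ker (T.toFun - z • T.domain.subtype)).map T.domain.subtype

/-- The null space of `T`. -/
def nullSpace (T : H →ₗ.[ℂ] H) : Submodule ℂ H := kerSub T 0

/-- The dimension of a subspace, as an element of `ℕ ∪ {∞}`. -/
def dimension (V : Submodule ℂ H) : ℕ∞ := Cardinal.toENat (Module.rank ℂ V)

/-- `S` has deficiency indices `(m, n)`. -/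
def HasDeficiencyIndices [CompleteSpace H] (S : H →ₗ.[ℂ] H) (m n : ℕ∞) : Prop :=
  dimension (kerSub S.adjoint Complex.I) = m ∧ dimension (kerSub S.adjoint (-Complex.I)) = n

/-- The sequence `v` in the domain of `S` satisfies
`(v j - v k, S (v j - v k)) → 0` as `j, k → ∞`. -/
def EnergyCauchy (S : H →ₗ.[ℂ] H) (v : ℕ → S.domain) : Prop :=
  Tendsto (fun jk : ℕ × ℕ =>
    inner ℂ ((v jk.1 - v jk.2 : S.domain) : H) (S (v jk.1 - v jk.2))) atTop (𝓝 0)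

theorem EnergyCauchy.zero (S : H →ₗ.[ℂ] H) : EnergyCauchy S (fun _ => 0) := by
  simp [EnergyCauchy]

theorem EnergyCauchy.smul {S : H →ₗ.[ℂ] H} {v : ℕ → S.domain} (hv : EnergyCauchy S v) (c : ℂ) :
    EnergyCauchy S (fun j => c • v j) := by
  have h := hv.const_mul ((starRingEnd ℂ) c * c)
  rw [mul_zero] at h
  refine h.congr fun jk => ?_
  rw [← smul_sub, LinearPMap.map_smul, Submodule.coe_smul, inner_smul_left, inner_smul_right]
  ring

theorem EnergyCauchy.add {S : H →ₗ.[ℂ] H} (hS : Nonneg S) {v w : ℕ → S.domain}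
    (hv : EnergyCauchy S v) (hw : EnergyCauchy S w) : EnergyCauchy S (fun j => v j + w j) := by
  have key : ∀ a b : S.domain,
      inner ℂ ((a + b : S.domain) : H) (S (a + b)) + inner ℂ ((a - b : S.domain) : H) (S (a - b))
        = 2 * inner ℂ (a : H) (S a) + 2 * inner ℂ (b : H) (S b) := by
    intro a b
    simp only [LinearPMap.map_add, LinearPMap.map_sub, Submodule.coe_add, Submodule.coe_sub,
      inner_add_left, inner_add_right, inner_sub_left, inner_sub_right]
    ring
  have hsum := (hv.const_mul (2 : ℂ)).add (hw.const_mul (2 : ℂ))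
  simp only [mul_zero, add_zero] at hsum
  refine squeeze_zero_norm (fun jk => ?_) (tendsto_zero_iff_norm_tendsto_zero.mp hsum)
  have e : (v jk.1 + w jk.1) - (v jk.2 + w jk.2) = (v jk.1 - v jk.2) + (w jk.1 - w jk.2) := by
    abel
  rw [e, ← key]
  set a := v jk.1 - v jk.2
  set b := w jk.1 - w jk.2
  have h1 := hS (a + b)
  have h2 := hS (a - b)
  have f1 : ∀ z : ℂ, 0 ≤ z.re → z.im = 0 → ‖z‖ = z.re := fun z hz hz' => by
    rw [← Complex.abs_re_eq_norm.mpr hz', abs_of_nonneg hz]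
  rw [f1 _ h1.1 h1.2, f1 _ (by rw [Complex.add_re]; exact add_nonneg h1.1 h2.1)
    (by rw [Complex.add_im, h1.2, h2.2, add_zero]), Complex.add_re]
  linarith [h2.1]

/-- The domain of the closure of the form `(u, S v)` of a non-negative operator `S`. -/
def closedFormDomain (S : H →ₗ.[ℂ] H) (hS : Nonneg S) : Submodule ℂ H where
  carrier := {x | ∃ v : ℕ → S.domain,
    Tendsto (fun j => (v j : H)) atTop (𝓝 x) ∧ EnergyCauchy S v}
  zero_mem' := ⟨fun _ => 0, by simp, EnergyCauchy.zero S⟩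
  add_mem' := by
    rintro x y ⟨v, hv, hv'⟩ ⟨w, hw, hw'⟩
    exact ⟨fun j => v j + w j, hv.add hw, hv'.add hS hw'⟩
  smul_mem' := by
    rintro c x ⟨v, hv, hv'⟩
    exact ⟨fun j => c • v j, hv.const_smul c, hv'.smul c⟩

variable [CompleteSpace H]

/-- The Friedrichs extension `S_F` of a non-negative operator `S`: the restriction of the adjoint
of `S` to those vectors `x` of its domain for which there are `v j` in the domain of `S` with
`v j → x` and `(v j - v k, S (v j - v k)) → 0`. -/
def friedrichs (S : H →ₗ.[ℂ] H) (hS : Nonneg S) : H →ₗ.[ℂ] H :=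
  S.adjoint.domRestrict (closedFormDomain S hS)

/-- The domain of the Krein--von Neumann extension of a non-negative operator `S`: those `x` in the
domain of the adjoint `S*` for which there are `v j` in the domain of `S` with
`S (v j) → S* x` and `(v j - v k, S (v j - v k)) → 0`. -/
def kreinDomain (S : H →ₗ.[ℂ] H) (hS : Nonneg S) : Submodule ℂ H where
  carrier := {x | ∃ hx : x ∈ S.adjoint.domain, ∃ v : ℕ → S.domain,
    Tendsto (fun j => S (v j)) atTop (𝓝 (S.adjoint ⟨x, hx⟩)) ∧ EnergyCauchy S v}
  zero_mem' := by
    refine ⟨Submodule.zero_mem _, fun _ => 0, ?_, EnergyCauchy.zero S⟩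
    have : (⟨0, Submodule.zero_mem _⟩ : S.adjoint.domain) = 0 := rfl
    simp [this]
  add_mem' := by
    rintro x y ⟨hx, v, hv, hv'⟩ ⟨hy, w, hw, hw'⟩
    refine ⟨Submodule.add_mem _ hx hy, fun j => v j + w j, ?_, hv'.add hS hw'⟩
    have : (⟨x + y, Submodule.add_mem _ hx hy⟩ : S.adjoint.domain) = ⟨x, hx⟩ + ⟨y, hy⟩ := rfl
    rw [this, LinearPMap.map_add]
    simpa only [LinearPMap.map_add] using hv.add hw
  smul_mem' := by
    rintro c x ⟨hx, v, hv, hv'⟩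
    refine ⟨Submodule.smul_mem _ c hx, fun j => c • v j, ?_, hv'.smul c⟩
    have : (⟨c • x, Submodule.smul_mem _ c hx⟩ : S.adjoint.domain) = c • ⟨x, hx⟩ := rfl
    rw [this, LinearPMap.map_smul]
    simpa only [LinearPMap.map_smul] using hv.const_smul c

/-- The Krein--von Neumann extension `S_K` of a non-negative operator `S`: the restriction of the
adjoint of `S` to `kreinDomain`. -/
def krein (S : H →ₗ.[ℂ] H) (hS : Nonneg S) : H →ₗ.[ℂ] H :=
  S.adjoint.domRestrict (kreinDomain S hS)

/-- For a closed subspace `N`, this is `I - P_N`, with `P_N` the orthogonal projection onto `N`: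
the orthogonal projection onto the orthogonal complement of `N`. -/
def complProj (N : Submodule ℂ H) : H →L[ℂ] H := Nᗮ.starProjection

/-- The operator `T` regarded in the closed subspace given by the orthogonal complement of `N`:
it maps `x`, in that complement and in the domain of `T`, to `(I - P_N) T x`. -/
def reduce (T : H →ₗ.[ℂ] H) (N : Submodule ℂ H) : Nᗮ →ₗ.[ℂ] Nᗮ where
  domain := T.domain.comap Nᗮ.subtype
  toFun := (Nᗮ.orthogonalProjectionOnto : H →ₗ[ℂ] Nᗮ) ∘ₗ T.toFun ∘ₗ
    ((Nᗮ.subtype.comp (T.domain.comap Nᗮ.subtype).subtype).codRestrict T.domain fun x => x.2)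

/-- The reduced Krein--von Neumann operator, acting in the orthogonal complement of the null space
of the Krein--von Neumann extension `S_K`: the part of `S_K` in that complement. -/
def reducedKrein (S : H →ₗ.[ℂ] H) (hS : Nonneg S) :
    (nullSpace (krein S hS))ᗮ →ₗ.[ℂ] (nullSpace (krein S hS))ᗮ :=
  reduce (krein S hS) (nullSpace (krein S hS))

/-- `B` is the inverse of the operator `T`, and it is bounded and defined everywhere. -/
def IsBoundedInverse (T : H →ₗ.[ℂ] H) (B : H →L[ℂ] H) : Prop :=
  (∀ x : T.domain, B (T x) = x) ∧ ∀ y : H, ∃ h : B y ∈ T.domain, T ⟨B y, h⟩ = y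

/-- The `n`-th singular value (`n = 0, 1, …`, in non-increasing order and with multiplicity) of a
bounded operator `T` between Hilbert spaces: the distance in operator norm from `T` to the
operators of rank at most `n`. -/
def singularValue (T : H →L[ℂ] H) (n : ℕ) : ℝ :=
  sInf {c : ℝ | ∃ R : H →L[ℂ] H, LinearMap.rank (R : H →ₗ[ℂ] H) ≤ (n : Cardinal) ∧ c = ‖T - R‖}

/-- The trace ideals, `T ∈ 𝓑_p`: for `p = ∞` the compact operators, and for `0 < p < ∞` the compact
operators whose sequence of singular values lies in `ℓ^p`. -/
def MemTraceIdeal (p : ℝ≥0∞) (T : H →L[ℂ] H) : Prop :=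
  IsCompactOperator T ∧ (p ≠ ∞ → Summable fun n : ℕ => singularValue T n ^ p.toReal)

end

end KreinVN

/-!
The idea is that the inverse of the reduced Krein–von Neumann operator is a compression of the
inverse of the Friedrichs extension `S_F`.

Let `N` be the null space of `S*`. As `S ≥ ε > 0` is closed, a sequence `v j` in its domain converges
as soon as `S (v j)` does, and `S v` is then the limit for `v = lim v j`. Therefore `S` has closed
range `Nᗮ`, and the domain of `S_K` is the sum of the domain of `S` and `N`, with
`S_K (u + n) = S u` (`krein_graph`). So the null space of `S_K` is `N`, and with `Q = I - P_N` the
part of `S_K` in `Nᗮ` maps `Q u` to `S u`. As `u = S_F⁻¹ S u`, its inverse is the restriction of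
`Q S_F⁻¹ Q` to `Nᗮ` (`isBoundedInverse_reducedKrein`).

The inverse of `S_F` is `ι ι†`, where `ι` is the map into `H` of the completion of the domain of `S`
in the inner product `(u, S v)` (`exists_friedrichs_inverse`). In particular it is bounded and
non-negative.

What remains is about bounded operators. For `T = S_F^{-1/2} Q` one has `T† T = Q S_F⁻¹ Q` and
`T† = Q S_F^{-1/2}`, while the singular values satisfy `s_n (T† T) = s_n (T) ^ 2` and
`s_n (T†) = s_n (T)` (`singularValue_adjoint_comp_self`, `singularValue_adjoint`). These identities,
and the fact that composing with contractions does not increase singular values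
(`MemTraceIdeal.comp_contractions`), follow directly from the description of `s_n` as the distance
to the operators of rank at most `n`.
-/

open Filter Topology
open scoped ENNReal

namespace KreinVN

noncomputable section

/-! ### Singular values and trace ideals -/

section SingularValues

variable {H : Type*} [NormedAddCommGroup H] [InnerProductSpace ℂ H]

theorem singularValue_le {T R : H →L[ℂ] H} {n : ℕ}
    (hR : LinearMap.rank (R : H →ₗ[ℂ] H) ≤ (n : Cardinal)) : singularValue T n ≤ ‖T - R‖ :=
  csInf_le ⟨0, by rintro _ ⟨R, -, rfl⟩; exact norm_nonneg _⟩ ⟨R, hR, rfl⟩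

theorem le_singularValue {T : H →L[ℂ] H} {n : ℕ} {c : ℝ}
    (h : ∀ R : H →L[ℂ] H, LinearMap.rank (R : H →ₗ[ℂ] H) ≤ (n : Cardinal) → c ≤ ‖T - R‖) :
    c ≤ singularValue T n := by
  refine le_csInf ⟨_, 0, ?_, rfl⟩ (by rintro _ ⟨R, hR, rfl⟩; exact h R hR)
  simp

theorem singularValue_nonneg (T : H →L[ℂ] H) (n : ℕ) : 0 ≤ singularValue T n :=
  le_singularValue fun _ _ => norm_nonneg _

/-- A trace ideal is carried into a trace ideal by two-sided composition with contractions, which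
may lead to another Hilbert space. -/
theorem MemTraceIdeal.comp_contractions.{u} {H₁ H₂ : Type u}
    [NormedAddCommGroup H₁] [InnerProductSpace ℂ H₁]
    [NormedAddCommGroup H₂] [InnerProductSpace ℂ H₂] {p : ℝ≥0∞} {T : H₁ →L[ℂ] H₁}
    (hT : MemTraceIdeal p T) (A : H₁ →L[ℂ] H₂) (B : H₂ →L[ℂ] H₁) (hA : ‖A‖ ≤ 1) (hB : ‖B‖ ≤ 1) :
    MemTraceIdeal p (A ∘L T ∘L B) := by
  refine ⟨(hT.1.comp_clm B).clm_comp A, fun hp => ?_⟩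
  refine Summable.of_nonneg_of_le (fun n => Real.rpow_nonneg (singularValue_nonneg _ n) _)
    (fun n => ?_) (hT.2 hp)
  refine Real.rpow_le_rpow (singularValue_nonneg _ n) (le_singularValue fun R hR => ?_)
    ENNReal.toReal_nonneg
  have hrank : LinearMap.rank ((A ∘L R ∘L B : H₂ →L[ℂ] H₂) : H₂ →ₗ[ℂ] H₂) ≤ (n : Cardinal) :=
    (LinearMap.rank_comp_le_right ((R : H₁ →ₗ[ℂ] H₁) ∘ₗ (B : H₂ →ₗ[ℂ] H₁)) _).trans
      ((LinearMap.rank_comp_le_left _ _).trans hR)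
  refine (singularValue_le hrank).trans ?_
  have e : A ∘L T ∘L B - A ∘L R ∘L B = A ∘L (T - R) ∘L B := by ext; simp
  rw [e]
  calc ‖A ∘L (T - R) ∘L B‖ ≤ ‖A‖ * (‖T - R‖ * ‖B‖) :=
        (ContinuousLinearMap.opNorm_comp_le _ _).trans
          (mul_le_mul_of_nonneg_left (ContinuousLinearMap.opNorm_comp_le _ _) (norm_nonneg _))
    _ ≤ 1 * (‖T - R‖ * 1) := by gcongr
    _ = ‖T - R‖ := by ring

/-- Subtracting from `T` its part with values in the range of an approximant `R` is at least as
good as subtracting `R`. -/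
theorem norm_sub_starProjection_comp_le (T R : H →L[ℂ] H)
    [(LinearMap.range (R : H →ₗ[ℂ] H)).HasOrthogonalProjection] :
    ‖T - (LinearMap.range (R : H →ₗ[ℂ] H)).starProjection ∘L T‖ ≤ ‖T - R‖ := by
  set K := LinearMap.range (R : H →ₗ[ℂ] H)
  have e : T - K.starProjection ∘L T = Kᗮ.starProjection ∘L (T - R) := by
    ext x
    have : K.starProjection (R x) = R x := Submodule.starProjection_eq_self_iff.mpr ⟨x, rfl⟩
    simp [Submodule.starProjection_orthogonal_val, this]
  rw [e]
  refine (ContinuousLinearMap.opNorm_comp_le _ _).trans ?_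
  exact mul_le_of_le_one_left (norm_nonneg _) (Submodule.starProjection_norm_le _)

theorem finiteDimensional_range_of_rank_le {R : H →L[ℂ] H} {n : ℕ}
    (hR : LinearMap.rank (R : H →ₗ[ℂ] H) ≤ (n : Cardinal)) :
    FiniteDimensional ℂ (LinearMap.range (R : H →ₗ[ℂ] H)) :=
  Module.rank_lt_aleph0_iff.mp (hR.trans_lt Cardinal.natCast_lt_aleph0)

variable [CompleteSpace H]

open ContinuousLinearMap

theorem rank_adjoint_le {R : H →L[ℂ] H} {n : ℕ}
    (hR : LinearMap.rank (R : H →ₗ[ℂ] H) ≤ (n : Cardinal)) :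
    LinearMap.rank ((adjoint R : H →L[ℂ] H) : H →ₗ[ℂ] H) ≤ (n : Cardinal) := by
  have := finiteDimensional_range_of_rank_le hR
  set K := LinearMap.range (R : H →ₗ[ℂ] H)
  have hPR : K.starProjection ∘L R = R := by
    ext x
    exact Submodule.starProjection_eq_self_iff.mpr ⟨x, rfl⟩
  have hRP : adjoint R ∘L K.starProjection = adjoint R := by
    conv_rhs => rw [← hPR, adjoint_comp, (isSelfAdjoint_starProjection K).adjoint_eq]
  rw [← hRP]
  refine (LinearMap.rank_comp_le_right (K.starProjection : H →ₗ[ℂ] H) _).trans ?_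
  rw [LinearMap.rank, Submodule.range_starProjection]
  exact hR

theorem singularValue_adjoint (T : H →L[ℂ] H) (n : ℕ) :
    singularValue (adjoint T) n = singularValue T n := by
  have key : ∀ T : H →L[ℂ] H, singularValue (adjoint T) n ≤ singularValue T n := fun T =>
    le_singularValue fun R hR => by
      refine (singularValue_le (rank_adjoint_le hR)).trans_eq ?_
      rw [← map_sub, LinearIsometryEquiv.norm_map]
  refine le_antisymm (key T) ?_
  conv_lhs => rw [← adjoint_adjoint T]
  exact key _

/-- No spectral theorem is needed: a rank `n` approximant of `T` gives one of `T† T` by projecting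
onto its range, and a rank `n` approximant of `T† T` gives one of `T` by projecting onto the
orthogonal complement of its kernel. -/
theorem singularValue_adjoint_comp_self (T : H →L[ℂ] H) (n : ℕ) :
    singularValue (adjoint T ∘L T) n = singularValue T n ^ 2 := by
  apply le_antisymm
  · rw [← Real.sqrt_le_left (singularValue_nonneg _ _)]
    refine le_singularValue fun R hR => ?_
    rw [Real.sqrt_le_left (norm_nonneg _)]
    have := finiteDimensional_range_of_rank_le hR
    set K := LinearMap.range (R : H →ₗ[ℂ] H) with hK
    have hrank : LinearMap.rank ((adjoint T ∘L K.starProjection ∘L T : H →L[ℂ] H) : H →ₗ[ℂ] H)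
        ≤ (n : Cardinal) := by
      refine (LinearMap.rank_comp_le_right
        ((K.starProjection : H →ₗ[ℂ] H) ∘ₗ (T : H →ₗ[ℂ] H)) _).trans ?_
      refine (LinearMap.rank_comp_le_left _ _).trans ?_
      rw [LinearMap.rank, Submodule.range_starProjection]
      exact hR
    refine (singularValue_le hrank).trans ?_
    have e : adjoint T ∘L T - adjoint T ∘L K.starProjection ∘L T
        = adjoint (Kᗮ.starProjection ∘L T) ∘L (Kᗮ.starProjection ∘L T) := by
      rw [adjoint_comp, (isSelfAdjoint_starProjection Kᗮ).adjoint_eq]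
      ext x
      have : Kᗮ.starProjection (Kᗮ.starProjection (T x)) = Kᗮ.starProjection (T x) :=
        Submodule.starProjection_eq_self_iff.mpr (Submodule.starProjection_apply_mem _ _)
      simp only [comp_apply, sub_apply, this]
      rw [← map_sub, Submodule.starProjection_orthogonal_val]
    have e' : Kᗮ.starProjection ∘L T = T - K.starProjection ∘L T := by
      ext x; simp [Submodule.starProjection_orthogonal_val]
    rw [e, norm_adjoint_comp_self, ← sq, e']
    exact pow_le_pow_left₀ (norm_nonneg _) (norm_sub_starProjection_comp_le T R) 2
  · refine le_singularValue fun R hR => ?_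
    have hR' := rank_adjoint_le hR
    have := finiteDimensional_range_of_rank_le hR'
    set K := LinearMap.range ((adjoint R : H →L[ℂ] H) : H →ₗ[ℂ] H) with hK
    have hrank : LinearMap.rank ((T ∘L K.starProjection : H →L[ℂ] H) : H →ₗ[ℂ] H)
        ≤ (n : Cardinal) := by
      refine (LinearMap.rank_comp_le_right (K.starProjection : H →ₗ[ℂ] H) _).trans ?_
      rw [LinearMap.rank, Submodule.range_starProjection]
      exact hR'
    have hle : ‖T - T ∘L K.starProjection‖ ≤ √‖adjoint T ∘L T - R‖ := by
      refine opNorm_le_bound _ (Real.sqrt_nonneg _) fun x => ?_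
      have e : (T - T ∘L K.starProjection) x = T (Kᗮ.starProjection x) := by
        simp [Submodule.starProjection_orthogonal_val]
      rw [e]
      set y := Kᗮ.starProjection x with hy
      have hRy : R y = 0 := by
        have : y ∈ Kᗮ := Submodule.starProjection_apply_mem _ _
        rw [← inner_self_eq_zero (𝕜 := ℂ), ← adjoint_inner_left]
        exact (Submodule.mem_orthogonal _ _).mp this _ ⟨R y, rfl⟩
      have h1 : ‖T y‖ ^ 2 ≤ ‖adjoint T ∘L T - R‖ * ‖y‖ ^ 2 := by
        calc ‖T y‖ ^ 2 = ‖inner ℂ ((adjoint T ∘L T - R) y) y‖ := by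
              rw [sub_apply, hRy, sub_zero, comp_apply, adjoint_inner_left,
                inner_self_eq_norm_sq_to_K]
              simp
          _ ≤ ‖(adjoint T ∘L T - R) y‖ * ‖y‖ := norm_inner_le_norm _ _
          _ ≤ (‖adjoint T ∘L T - R‖ * ‖y‖) * ‖y‖ := by gcongr; exact le_opNorm _ _
          _ = _ := by ring
      have h2 : ‖T y‖ ≤ √‖adjoint T ∘L T - R‖ * ‖y‖ := by
        rw [← Real.sqrt_sq (norm_nonneg (T y)), ← Real.sqrt_sq (norm_nonneg y),
          ← Real.sqrt_mul (norm_nonneg _)]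
        exact Real.sqrt_le_sqrt h1
      exact h2.trans (mul_le_mul_of_nonneg_left (Submodule.norm_starProjection_apply_le _ _)
        (Real.sqrt_nonneg _))
    calc singularValue T n ^ 2 ≤ √‖adjoint T ∘L T - R‖ ^ 2 :=
          pow_le_pow_left₀ (singularValue_nonneg _ _) ((singularValue_le hrank).trans hle) 2
      _ = _ := Real.sq_sqrt (norm_nonneg _)

/-- The estimate `‖T x‖ ^ 2 ≤ ‖T† T x‖ ‖x‖` turns finite nets of the image of the unit ball under
`T† T` into finite nets of its image under `T`. -/
theorem isCompactOperator_of_adjoint_comp_self {T : H →L[ℂ] H}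
    (h : IsCompactOperator (adjoint T ∘L T)) : IsCompactOperator T := by
  refine (isCompactOperator_iff_isCompact_closure_image_closedBall (T : H →ₗ[ℂ] H) one_pos).mpr ?_
  refine TotallyBounded.isCompact_of_isClosed (TotallyBounded.closure ?_) isClosed_closure
  have hc := (h.isCompact_closure_image_closedBall (f := ((adjoint T ∘L T : H →L[ℂ] H) :
    H →ₗ[ℂ] H)) 1).totallyBounded.subset subset_closure
  rw [Metric.totallyBounded_iff]
  intro r hr
  obtain ⟨t, hts, htf, ht⟩ := Metric.finite_approx_of_totallyBounded hc (r ^ 2 / 2) (by positivity)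
  have hpre : ∀ y ∈ t, ∃ z ∈ Metric.closedBall (0 : H) 1, (adjoint T ∘L T) z = y :=
    fun y hy => hts hy
  choose! g hg hgt using hpre
  refine ⟨(fun y => T (g y)) '' t, htf.image _, ?_⟩
  rintro _ ⟨x, hx, rfl⟩
  obtain ⟨y, hy, hxy⟩ := Set.mem_iUnion₂.mp (ht ⟨x, hx, rfl⟩)
  refine Set.mem_iUnion₂.mpr ⟨T (g y), ⟨y, hy, rfl⟩, ?_⟩
  have hd : ‖(adjoint T ∘L T) (x - g y)‖ < r ^ 2 / 2 := by
    rw [map_sub, show (adjoint T ∘L T) (g y) = y from hgt y hy, ← dist_eq_norm]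
    exact hxy
  have hn : ‖x - g y‖ ≤ 2 := by
    have h1 := mem_closedBall_zero_iff.mp hx
    have h2 := mem_closedBall_zero_iff.mp (hg y hy)
    linarith [norm_sub_le x (g y)]
  have hsq : ‖T (x - g y)‖ ^ 2 < r ^ 2 := by
    rw [apply_norm_sq_eq_inner_adjoint_left]
    calc RCLike.re (inner ℂ ((adjoint T ∘L T) (x - g y)) (x - g y))
        ≤ ‖(adjoint T ∘L T) (x - g y)‖ * ‖x - g y‖ := re_inner_le_norm _ _
      _ ≤ ‖(adjoint T ∘L T) (x - g y)‖ * 2 := by gcongr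
      _ < r ^ 2 := by linarith
  rw [Metric.mem_ball, dist_eq_norm]
  change ‖T x - T (g y)‖ < r
  rw [← map_sub]
  exact lt_of_pow_lt_pow_left₀ 2 hr.le hsq

theorem isCompactOperator_adjoint_comp_self_iff {T : H →L[ℂ] H} :
    IsCompactOperator (adjoint T ∘L T) ↔ IsCompactOperator T :=
  ⟨isCompactOperator_of_adjoint_comp_self, fun h => h.clm_comp (adjoint T)⟩

theorem isCompactOperator_adjoint {T : H →L[ℂ] H} (h : IsCompactOperator T) :
    IsCompactOperator (adjoint T) := by
  apply isCompactOperator_of_adjoint_comp_self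
  rw [adjoint_adjoint]
  exact h.comp_clm (adjoint T)

theorem MemTraceIdeal.adjoint {p : ℝ≥0∞} {T : H →L[ℂ] H} (h : MemTraceIdeal p T) :
    MemTraceIdeal p (ContinuousLinearMap.adjoint T) :=
  ⟨isCompactOperator_adjoint h.1, fun hp => by simpa only [singularValue_adjoint] using h.2 hp⟩

theorem memTraceIdeal_adjoint_comp_self_iff {p : ℝ≥0∞} {T : H →L[ℂ] H} :
    MemTraceIdeal p (ContinuousLinearMap.adjoint T ∘L T) ↔ MemTraceIdeal (2 * p) T := by
  have hp : 2 * p ≠ ∞ ↔ p ≠ ∞ := by simp [ENNReal.mul_eq_top]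
  have hs : ∀ n, singularValue (ContinuousLinearMap.adjoint T ∘L T) n ^ p.toReal
      = singularValue T n ^ (2 * p).toReal := fun n => by
    rw [singularValue_adjoint_comp_self, ENNReal.toReal_mul, ENNReal.toReal_ofNat,
      Real.rpow_mul (singularValue_nonneg _ _), Real.rpow_two]
  simp only [MemTraceIdeal, hp, hs, isCompactOperator_adjoint_comp_self_iff]

end SingularValues

/-! ### Unbounded operators with a positive lower bound -/

section Extensions

universe u

variable {H : Type u} [NormedAddCommGroup H] [InnerProductSpace ℂ H]

theorem Nonneg.inner_symm {S : H →ₗ.[ℂ] H} (hS : Nonneg S) (x y : S.domain) :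
    inner ℂ (S x) (y : H) = inner ℂ (x : H) (S y) := by
  have h1 := (hS (x + y)).2
  have h2 := (hS (x + Complex.I • y)).2
  have hx := (hS x).2
  have hy := (hS y).2
  rw [← inner_conj_symm]
  simp only [LinearPMap.map_add, LinearPMap.map_smul, Submodule.coe_add, Submodule.coe_smul,
    inner_add_left, inner_add_right, inner_smul_left, inner_smul_right, Complex.add_im,
    Complex.mul_im, Complex.mul_re, Complex.add_re, Complex.conj_I, Complex.neg_re, Complex.neg_im,
    Complex.I_re, Complex.I_im, hx, hy] at h1 h2
  apply Complex.ext
  · rw [Complex.conj_re]; linarith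
  · rw [Complex.conj_im]; linarith

theorem mem_nullSpace {T : H →ₗ.[ℂ] H} {x : H} :
    x ∈ nullSpace T ↔ ∃ h : x ∈ T.domain, T ⟨x, h⟩ = 0 := by
  simp [nullSpace, kerSub]

theorem OpGe.norm_le {S : H →ₗ.[ℂ] H} {ε : ℝ} (hS : OpGe S ε) (x : S.domain) :
    ε * ‖(x : H)‖ ≤ ‖S x‖ := by
  rcases eq_or_lt_of_le (norm_nonneg (x : H)) with h | h
  · rw [← h, mul_zero]; exact norm_nonneg _
  · refine le_of_mul_le_mul_right ?_ h
    calc ε * ‖(x : H)‖ * ‖(x : H)‖ = ε * ‖(x : H)‖ ^ 2 := by ring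
      _ ≤ (inner ℂ (x : H) (S x)).re := (hS x).1
      _ ≤ ‖(x : H)‖ * ‖S x‖ := (Complex.re_le_norm _).trans (norm_inner_le_norm _ _)
      _ = ‖S x‖ * ‖(x : H)‖ := mul_comm _ _

/-! ### The energy space and the inverse of the Friedrichs extension -/

/-- The domain of `S`, to be given the inner product `(u, S v)`. -/
def FormDomain (S : H →ₗ.[ℂ] H) : Type u := S.domain

instance (S : H →ₗ.[ℂ] H) : AddCommGroup (FormDomain S) :=
  inferInstanceAs (AddCommGroup S.domain)

instance (S : H →ₗ.[ℂ] H) : Module ℂ (FormDomain S) :=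
  inferInstanceAs (Module ℂ S.domain)

/-- The inner product `(u, S v)` on the domain of a strictly positive operator `S`. -/
@[reducible] def formCore {S : H →ₗ.[ℂ] H} {ε : ℝ} (hε : 0 < ε) (hS : OpGe S ε) :
    InnerProductSpace.Core ℂ (FormDomain S) where
  inner u v := inner ℂ ((show S.domain from u : S.domain) : H) (S (show S.domain from v))
  conj_inner_symm u v := by
    rw [inner_conj_symm]
    exact (hS.nonneg hε.le).inner_symm _ _
  re_inner_nonneg u := (hS.nonneg hε.le _).1
  add_left u v w := inner_add_left (𝕜 := ℂ) (E := H) _ _ _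
  smul_left u v c := inner_smul_left (𝕜 := ℂ) (E := H) _ _ _
  definite u hu := by
    have h := (hS u).1
    have hu' : inner ℂ ((show S.domain from u : S.domain) : H) (S (show S.domain from u)) = 0 := hu
    rw [hu', Complex.zero_re] at h
    have h0 : ‖((show S.domain from u : S.domain) : H)‖ ^ 2 = 0 :=
      le_antisymm (nonpos_of_mul_nonpos_right h hε) (sq_nonneg _)
    exact Subtype.ext (norm_eq_zero.mp (pow_eq_zero_iff two_ne_zero |>.mp h0))

/-- The energy space of `S ≥ ε > 0`: a Hilbert space `V` in which the domain of `S`, with the inner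
product `(u, S v)`, is dense; it is mapped into `H` by the extension `ι` of the inclusion. -/
theorem OpGe.exists_energySpace [CompleteSpace H] {S : H →ₗ.[ℂ] H} {ε : ℝ} (hε : 0 < ε)
    (hS : OpGe S ε) :
    ∃ (V : Type u) (_ : NormedAddCommGroup V) (_ : InnerProductSpace ℂ V) (_ : CompleteSpace V)
      (j : S.domain →ₗ[ℂ] V) (ι : V →L[ℂ] H), DenseRange j ∧
      (∀ u v, inner ℂ (j u) (j v) = inner ℂ (u : H) (S v)) ∧ ∀ u, ι (j u) = u := by
  let _ : InnerProductSpace.Core ℂ (FormDomain S) := formCore hε hS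
  let _ : NormedAddCommGroup (FormDomain S) := InnerProductSpace.Core.toNormedAddCommGroup (𝕜 := ℂ)
  let _ : InnerProductSpace ℂ (FormDomain S) := InnerProductSpace.ofCore (formCore hε hS).toCore
  let e : FormDomain S →L[ℂ] UniformSpace.Completion (FormDomain S) :=
    UniformSpace.Completion.toComplL
  have he : DenseRange e := UniformSpace.Completion.denseRange_coe
  let f : FormDomain S →ₗ[ℂ] H := S.domain.subtype
  have hbound : ∃ C, ∀ x, ‖f x‖ ≤ C * ‖e x‖ := by
    refine ⟨(√ε)⁻¹, fun x => ?_⟩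
    have hx : ‖e x‖ = ‖x‖ := UniformSpace.Completion.norm_coe x
    have h1 : ε * ‖f x‖ ^ 2 ≤ ‖x‖ ^ 2 := by
      rw [← inner_self_eq_norm_sq (𝕜 := ℂ) x]
      exact (hS x).1
    have h2 : √ε * ‖f x‖ ≤ ‖x‖ := by
      refine le_of_sq_le_sq ?_ (norm_nonneg _)
      rwa [mul_pow, Real.sq_sqrt hε.le]
    rw [hx, inv_mul_eq_div, le_div_iff₀ (Real.sqrt_pos.mpr hε), mul_comm]
    exact h2
  refine ⟨UniformSpace.Completion (FormDomain S), inferInstance, inferInstance, inferInstance,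
    (e : FormDomain S →ₗ[ℂ] _), f.extendOfNorm (e : FormDomain S →ₗ[ℂ] _), he, ?_, ?_⟩
  · intro u v
    exact UniformSpace.Completion.inner_coe (𝕜 := ℂ) _ _
  · intro u
    exact LinearMap.extendOfNorm_eq he hbound u

variable [CompleteSpace H]

/-- The inverse of the Friedrichs extension is `ι ι†`, with `ι` the map of the energy space into
`H`; this form makes its boundedness and positivity evident. -/
theorem exists_friedrichs_inverse {S : H →ₗ.[ℂ] H} (hdense : Dense (S.domain : Set H))
    {ε : ℝ} (hε : 0 < ε) (hS : OpGe S ε) :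
    ∃ B : H →L[ℂ] H, B.IsPositive ∧ IsBoundedInverse (friedrichs S (hS.nonneg hε.le)) B := by
  obtain ⟨V, _, _, _, j, ι, hj, hinner, hι⟩ := hS.exists_energySpace hε
  have hCauchy : ∀ v : ℕ → S.domain, EnergyCauchy S v ↔ CauchySeq fun n => j (v n) := by
    intro v
    rw [cauchySeq_iff_tendsto_dist_atTop_0, EnergyCauchy]
    simp only [← hinner, dist_eq_norm, ← map_sub, inner_self_eq_norm_sq_to_K]
    rw [tendsto_zero_iff_norm_tendsto_zero]
    simp only [norm_pow, RCLike.norm_ofReal, abs_norm]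
    constructor
    · intro h
      simpa [Real.sqrt_sq] using h.sqrt
    · intro h
      simpa using h.pow 2
  have hadj : ∀ (y : H) (w : S.domain), inner ℂ (j w) (ι.adjoint y) = inner ℂ (w : H) y :=
    fun y w => by rw [ContinuousLinearMap.adjoint_inner_right, hι]
  have hS' := hS.nonneg hε.le
  refine ⟨ι ∘L ι.adjoint, ContinuousLinearMap.isPositive_self_comp_adjoint ι, ?_, ?_⟩
  · rintro ⟨x, ⟨v, hv, hvC⟩, hx⟩
    rw [show friedrichs S hS' ⟨x, ⟨v, hv, hvC⟩, hx⟩ = S.adjoint ⟨x, hx⟩ from rfl]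
    obtain ⟨ξ, hξ⟩ := cauchySeq_tendsto_of_complete ((hCauchy v).mp hvC)
    have hιξ : ι ξ = x := by
      refine tendsto_nhds_unique ?_ hv
      simpa only [hι, Function.comp_def] using (ι.continuous.tendsto ξ).comp hξ
    have hξ' : ξ = ι.adjoint (S.adjoint ⟨x, hx⟩) := by
      refine Dense.eq_of_inner_right ℂ (S := LinearMap.range j) hj ?_
      rintro _ ⟨w, rfl⟩
      rw [hadj]
      refine tendsto_nhds_unique (tendsto_const_nhds.inner hξ) ?_
      have h := LinearPMap.adjoint_isFormalAdjoint hdense ⟨x, hx⟩ w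
      rw [← inner_conj_symm, h, inner_conj_symm]
      refine (tendsto_const_nhds.inner hv).congr fun n => ?_
      rw [hinner, hS'.inner_symm]
    rw [ContinuousLinearMap.comp_apply, ← hξ', hιξ]
  · intro y
    obtain ⟨s, hs, hsξ⟩ := mem_closure_iff_seq_limit.mp (hj (ι.adjoint y))
    choose v hv using hs
    obtain rfl : (fun n => j (v n)) = s := funext hv
    have hlim : Tendsto (fun n => (v n : H)) atTop (𝓝 (ι (ι.adjoint y))) := by
      simpa only [hι, Function.comp_def] using (ι.continuous.tendsto (ι.adjoint y)).comp hsξ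
    have hsol : ∀ w : S.domain, inner ℂ y (w : H) = inner ℂ ((ι ∘L ι.adjoint) y) (S w) := by
      intro w
      rw [← inner_conj_symm, ← inner_conj_symm _ (S w)]
      congr 1
      rw [← hadj]
      refine tendsto_nhds_unique (tendsto_const_nhds.inner hsξ) ?_
      refine (tendsto_const_nhds.inner hlim).congr fun n => ?_
      rw [hinner, hS'.inner_symm]
    have hdom : (ι ∘L ι.adjoint) y ∈ S.adjoint.domain :=
      LinearPMap.mem_adjoint_domain_of_exists _ ⟨y, hsol⟩
    exact ⟨⟨⟨v, hlim, (hCauchy v).mpr hsξ.cauchySeq⟩, hdom⟩,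
      LinearPMap.adjoint_apply_eq hdense ⟨_, hdom⟩ hsol⟩

/-! ### The Krein–von Neumann extension -/

theorem nullSpace_krein (S : H →ₗ.[ℂ] H) (hS : Nonneg S) :
    nullSpace (krein S hS) = nullSpace S.adjoint := by
  ext x
  rw [mem_nullSpace, mem_nullSpace]
  constructor
  · rintro ⟨⟨_, hx⟩, h⟩
    exact ⟨hx, h⟩
  · rintro ⟨hx, h⟩
    exact ⟨⟨⟨hx, fun _ => 0, by rw [h]; simp, EnergyCauchy.zero S⟩, hx⟩, h⟩

theorem nullSpace_adjoint {S : H →ₗ.[ℂ] H} (hdense : Dense (S.domain : Set H)) :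
    nullSpace S.adjoint = (LinearMap.range S.toFun)ᗮ := by
  ext x
  rw [mem_nullSpace, Submodule.mem_orthogonal']
  constructor
  · rintro ⟨hx, h⟩ _ ⟨w, rfl⟩
    have := LinearPMap.adjoint_isFormalAdjoint hdense ⟨x, hx⟩ w
    rw [h, inner_zero_left] at this
    exact this.symm
  · intro h
    have h0 : ∀ w : S.domain, inner ℂ (0 : H) (w : H) = inner ℂ x (S w) := fun w => by
      rw [inner_zero_left]; exact (h _ ⟨w, rfl⟩).symm
    have hx := LinearPMap.mem_adjoint_domain_of_exists x ⟨0, h0⟩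
    exact ⟨hx, LinearPMap.adjoint_apply_eq hdense ⟨x, hx⟩ h0⟩

/-- A closed operator `S ≥ ε > 0` has sequentially closed range: preimages of a
convergent sequence converge. -/
theorem OpGe.exists_apply_eq_of_tendsto {S : H →ₗ.[ℂ] H} (hclosed : S.IsClosed) {ε : ℝ}
    (hε : 0 < ε) (hS : OpGe S ε) {v : ℕ → S.domain} {y : H}
    (hv : Tendsto (fun n => S (v n)) atTop (𝓝 y)) : ∃ x : S.domain, S x = y := by
  have hC : CauchySeq fun n => (v n : H) := by
    rw [cauchySeq_iff_tendsto_dist_atTop_0]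
    have h := (cauchySeq_iff_tendsto_dist_atTop_0.mp hv.cauchySeq).const_mul ε⁻¹
    rw [mul_zero] at h
    refine squeeze_zero (fun _ => dist_nonneg) (fun n => ?_) h
    rw [dist_eq_norm, dist_eq_norm, inv_mul_eq_div, le_div_iff₀ hε, mul_comm]
    simpa only [LinearPMap.map_sub, Submodule.coe_sub] using hS.norm_le (v n.1 - v n.2)
  obtain ⟨x, hx⟩ := cauchySeq_tendsto_of_complete hC
  have hmem : (x, y) ∈ S.graph :=
    hclosed.mem_of_tendsto (hx.prodMk_nhds hv) (Eventually.of_forall fun n => S.mem_graph (v n))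
  obtain ⟨z, -, hz⟩ := (LinearPMap.mem_graph_iff S).mp hmem
  exact ⟨z, hz⟩

theorem range_eq_nullSpace_adjoint_orthogonal {S : H →ₗ.[ℂ] H}
    (hdense : Dense (S.domain : Set H)) (hclosed : S.IsClosed) {ε : ℝ}
    (hε : 0 < ε) (hS : OpGe S ε) :
    LinearMap.range S.toFun = (nullSpace S.adjoint)ᗮ := by
  rw [nullSpace_adjoint hdense, Submodule.orthogonal_orthogonal_eq_closure]
  refine (IsClosed.submodule_topologicalClosure_eq ?_).symm
  refine IsSeqClosed.isClosed fun s y hs hy => ?_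
  choose v hv using hs
  exact hS.exists_apply_eq_of_tendsto hclosed hε (v := v) (hy.congr fun n => (hv n).symm)

theorem exists_adjoint_apply_eq {S : H →ₗ.[ℂ] H} (hdense : Dense (S.domain : Set H))
    (hS : Nonneg S) (u : S.domain) :
    ∃ h : (u : H) ∈ S.adjoint.domain, S.adjoint ⟨u, h⟩ = S u := by
  have h0 : ∀ w : S.domain, inner ℂ (S u) (w : H) = inner ℂ (u : H) (S w) := hS.inner_symm u
  have h := LinearPMap.mem_adjoint_domain_of_exists (u : H) ⟨S u, h0⟩
  exact ⟨h, LinearPMap.adjoint_apply_eq hdense ⟨u, h⟩ h0⟩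

/-- Since `S` is closed and strictly positive, the domain of its Krein–von Neumann extension is the
sum of the domain of `S` and the null space of `S*`; the extension acts as `S` on the first summand
and annihilates the second. -/
theorem krein_graph {S : H →ₗ.[ℂ] H} (hdense : Dense (S.domain : Set H)) (hclosed : S.IsClosed)
    {ε : ℝ} (hε : 0 < ε) (hS : OpGe S ε) {x y : H} :
    (∃ h : x ∈ (krein S (hS.nonneg hε.le)).domain, krein S (hS.nonneg hε.le) ⟨x, h⟩ = y) ↔
      ∃ u : S.domain, x - u ∈ nullSpace S.adjoint ∧ S u = y := by
  have hS' := hS.nonneg hε.le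
  constructor
  · rintro ⟨⟨⟨hx, v, hv, -⟩, hx'⟩, rfl⟩
    obtain ⟨u, hu⟩ := hS.exists_apply_eq_of_tendsto hclosed hε hv
    obtain ⟨hu', huS⟩ := exists_adjoint_apply_eq hdense hS' u
    refine ⟨u, mem_nullSpace.mpr ⟨Submodule.sub_mem _ hx hu', ?_⟩, hu⟩
    rw [show (⟨x - u, Submodule.sub_mem _ hx hu'⟩ : S.adjoint.domain) = ⟨x, hx⟩ - ⟨u, hu'⟩ from rfl,
      LinearPMap.map_sub, huS, hu, sub_self]
  · rintro ⟨u, hxu, rfl⟩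
    obtain ⟨hn, hn0⟩ := mem_nullSpace.mp hxu
    obtain ⟨hu', huS⟩ := exists_adjoint_apply_eq hdense hS' u
    have hx : x ∈ S.adjoint.domain := by simpa using Submodule.add_mem _ hn hu'
    have hval : S.adjoint ⟨x, hx⟩ = S u := by
      have e : (⟨x, hx⟩ : S.adjoint.domain) = ⟨x - u, hn⟩ + ⟨u, hu'⟩ := Subtype.ext (by simp)
      rw [e, LinearPMap.map_add, hn0, huS, zero_add]
    have hE : EnergyCauchy S fun _ => u := by simp [EnergyCauchy]
    exact ⟨⟨⟨hx, fun _ => u, by rw [hval]; exact tendsto_const_nhds, hE⟩, hx⟩, hval⟩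

/-- If the graph of `T` consists of the pairs `(x, S u)` with `x - u ∈ N`, where `S` maps its domain
onto `Nᗮ`, and if `B` inverts `S` from the left, then the part of `T` in `Nᗮ` is inverted by the
compression of `B` to `Nᗮ`: it maps the projection of `u` onto `Nᗮ` to `S u`. -/
theorem isBoundedInverse_reduce {S T : H →ₗ.[ℂ] H} {N : Submodule ℂ H} (hNN : Nᗮᗮ = N)
    (hran : LinearMap.range S.toFun = Nᗮ)
    (hgraph : ∀ x y, (∃ h : x ∈ T.domain, T ⟨x, h⟩ = y) ↔ ∃ u : S.domain, x - u ∈ N ∧ S u = y)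
    {B : H →L[ℂ] H} (hBS : ∀ u : S.domain, B (S u) = u) :
    IsBoundedInverse (reduce T N) (Nᗮ.orthogonalProjectionOnto ∘L B ∘L Nᗮ.subtypeL) := by
  constructor
  · rintro ⟨⟨x, hxN⟩, hx⟩
    have hx' : x ∈ T.domain := hx
    obtain ⟨u, hu, hSu⟩ := (hgraph x _).mp ⟨hx', rfl⟩
    have hred : ((reduce T N ⟨⟨x, hxN⟩, hx⟩ : Nᗮ) : H) = S u := by
      change Nᗮ.starProjection (T ⟨x, hx'⟩) = S u
      rw [← hSu]
      exact Submodule.starProjection_eq_self_iff.mpr (hran ▸ ⟨u, rfl⟩)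
    apply Subtype.ext
    change Nᗮ.starProjection (B (reduce T N ⟨⟨x, hxN⟩, hx⟩ : Nᗮ)) = x
    rw [hred, hBS]
    refine Submodule.eq_starProjection_of_mem_orthogonal hxN ?_
    rw [hNN, ← neg_sub]
    exact N.neg_mem hu
  · rintro ⟨y, hy⟩
    obtain ⟨u, rfl⟩ : ∃ u : S.domain, S u = y := by
      rw [← hran] at hy; exact hy
    have hC : ((Nᗮ.orthogonalProjectionOnto ∘L B ∘L Nᗮ.subtypeL) ⟨S u, hy⟩ : H)
        = Nᗮ.starProjection u := by
      change Nᗮ.starProjection (B (S u)) = _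
      rw [hBS]
    have hmem : Nᗮ.starProjection (u : H) - u ∈ N := by
      have h := Submodule.sub_starProjection_mem_orthogonal (K := Nᗮ) (u : H)
      rw [hNN] at h
      rw [← neg_sub]
      exact N.neg_mem h
    obtain ⟨h, hval⟩ := (hgraph _ _).mpr ⟨u, hmem, rfl⟩
    have hdom : ((Nᗮ.orthogonalProjectionOnto ∘L B ∘L Nᗮ.subtypeL) ⟨S u, hy⟩ : H) ∈ T.domain := by
      rw [hC]; exact h
    refine ⟨hdom, Subtype.ext ?_⟩
    change Nᗮ.starProjection (T ⟨_, hdom⟩) = S u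
    rw [show T ⟨_, hdom⟩ = T ⟨_, h⟩ from congrArg _ (Subtype.ext hC), hval]
    exact Submodule.starProjection_eq_self_iff.mpr hy

/-- The inverse of the reduced Krein–von Neumann operator is the compression of the inverse of
the Friedrichs extension. -/
theorem isBoundedInverse_reducedKrein {S : H →ₗ.[ℂ] H} (hdense : Dense (S.domain : Set H))
    (hclosed : S.IsClosed) {ε : ℝ} (hε : 0 < ε) (hS : OpGe S ε) {B : H →L[ℂ] H}
    (hB : IsBoundedInverse (friedrichs S (hS.nonneg hε.le)) B) :
    IsBoundedInverse (reducedKrein S (hS.nonneg hε.le))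
      ((nullSpace (krein S (hS.nonneg hε.le)))ᗮ.orthogonalProjectionOnto ∘L B ∘L
        (nullSpace (krein S (hS.nonneg hε.le)))ᗮ.subtypeL) := by
  have hS' := hS.nonneg hε.le
  have hN := nullSpace_krein S hS'
  refine isBoundedInverse_reduce (S := S) ?_ ?_ (fun x y => ?_) fun u => ?_
  · rw [hN, nullSpace_adjoint hdense, Submodule.triorthogonal_eq_orthogonal]
  · rw [hN]
    exact range_eq_nullSpace_adjoint_orthogonal hdense hclosed hε hS
  · rw [hN]
    exact krein_graph hdense hclosed hε hS
  -- The Friedrichs extension extends `S`, as constant sequences show.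
  · obtain ⟨hu', huS⟩ := exists_adjoint_apply_eq hdense hS' u
    have hE : EnergyCauchy S fun _ => u := by simp [EnergyCauchy]
    have := hB.1 ⟨u, ⟨fun _ => u, tendsto_const_nhds, hE⟩, hu'⟩
    rwa [show friedrichs S hS' ⟨u, ⟨fun _ => u, tendsto_const_nhds, hE⟩, hu'⟩ =
      S.adjoint ⟨u, hu'⟩ from rfl, huS] at this

end Extensions

end

end KreinVN

theorem theorem4p3 {H : Type*} [NormedAddCommGroup H] [InnerProductSpace ℂ H] [CompleteSpace H]
    [TopologicalSpace.SeparableSpace H]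
    (S : H →ₗ.[ℂ] H) (hdense : Dense (S.domain : Set H)) (hclosed : S.IsClosed)
    (ε : ℝ) (hε : 0 < ε) (hS : KreinVN.OpGe S ε)
    (r : ℕ∞) (hr : r ≠ 0) (hdef : KreinVN.HasDeficiencyIndices S r r) :
    let hS' : KreinVN.Nonneg S := hS.nonneg hε.le
    let SF := KreinVN.friedrichs S hS'
    let SK := KreinVN.krein S hS'
    -- `I - P`, with `P` the orthogonal projection onto the null space of `SK`
    let Q : H →L[ℂ] H := KreinVN.complProj (KreinVN.nullSpace SK)
    KreinVN.nullSpace SK = KreinVN.nullSpace S.adjoint ∧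
    -- `SFinv`, `SFinvSqrt` and `SKhatInv` are the inverse of `SF`, the non-negative square root
    -- of that inverse, and the inverse of the reduced Krein--von Neumann operator
    ∃ (SFinv SFinvSqrt : H →L[ℂ] H)
      (SKhatInv : (KreinVN.nullSpace SK)ᗮ →L[ℂ] (KreinVN.nullSpace SK)ᗮ),
      KreinVN.IsBoundedInverse SF SFinv ∧
      SFinvSqrt.IsPositive ∧ SFinvSqrt ∘L SFinvSqrt = SFinv ∧
      KreinVN.IsBoundedInverse (KreinVN.reducedKrein S hS') SKhatInv ∧
      ∀ p : ℝ≥0∞, 0 < p →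
        [KreinVN.MemTraceIdeal p SKhatInv,
          KreinVN.MemTraceIdeal p (Q ∘L SFinv ∘L Q),
          KreinVN.MemTraceIdeal (2 * p) (Q ∘L SFinvSqrt),
          KreinVN.MemTraceIdeal (2 * p) (SFinvSqrt ∘L Q)].TFAE ∧
        (KreinVN.MemTraceIdeal p SFinv → KreinVN.MemTraceIdeal p SKhatInv) := by
  intro hS' SF SK Q
  obtain ⟨B, hBpos, hB⟩ := KreinVN.exists_friedrichs_inverse hdense hε hS
  have hB0 : 0 ≤ B := (ContinuousLinearMap.nonneg_iff_isPositive B).mpr hBpos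
  set N := KreinVN.nullSpace SK
  have hsqrt : (CFC.sqrt B).IsPositive :=
    (ContinuousLinearMap.nonneg_iff_isPositive _).mp (CFC.sqrt_nonneg B)
  have hmul : CFC.sqrt B ∘L CFC.sqrt B = B := CFC.sqrt_mul_sqrt_self B hB0
  refine ⟨KreinVN.nullSpace_krein S hS', B, CFC.sqrt B,
    Nᗮ.orthogonalProjectionOnto ∘L B ∘L Nᗮ.subtypeL, hB, hsqrt, hmul,
    KreinVN.isBoundedInverse_reducedKrein hdense hclosed hε hS hB, fun p _ => ?_⟩
  have hP : ‖Nᗮ.orthogonalProjectionOnto‖ ≤ 1 := Submodule.orthogonalProjectionOnto_norm_le _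
  have hI : ‖Nᗮ.subtypeL‖ ≤ 1 := Submodule.norm_subtypeL_le _
  have hQsa : ContinuousLinearMap.adjoint Q = Q := (isSelfAdjoint_starProjection Nᗮ).adjoint_eq
  have hRsa : ContinuousLinearMap.adjoint (CFC.sqrt B) = CFC.sqrt B :=
    hsqrt.isSelfAdjoint.adjoint_eq
  have hadj : ContinuousLinearMap.adjoint (CFC.sqrt B ∘L Q) = Q ∘L CFC.sqrt B := by
    rw [ContinuousLinearMap.adjoint_comp, hQsa, hRsa]
  have hsq : ContinuousLinearMap.adjoint (CFC.sqrt B ∘L Q) ∘L (CFC.sqrt B ∘L Q) = Q ∘L B ∘L Q := by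
    rw [hadj]
    conv_rhs => rw [← hmul]
    rfl
  -- `Q = ι P`, with `P` the projection onto the complement of the null space and `ι` its inclusion,
  -- so `Q B Q` and the compression `P B ι` are obtained from each other by contractions.
  have h12 : KreinVN.MemTraceIdeal p (Nᗮ.orthogonalProjectionOnto ∘L B ∘L Nᗮ.subtypeL) →
      KreinVN.MemTraceIdeal p (Q ∘L B ∘L Q) := fun h =>
    h.comp_contractions Nᗮ.subtypeL Nᗮ.orthogonalProjectionOnto hI hP
  have h21 : KreinVN.MemTraceIdeal p (Q ∘L B ∘L Q) →
      KreinVN.MemTraceIdeal p (Nᗮ.orthogonalProjectionOnto ∘L B ∘L Nᗮ.subtypeL) := fun h => by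
    have e : Nᗮ.orthogonalProjectionOnto ∘L (Q ∘L B ∘L Q) ∘L Nᗮ.subtypeL
        = Nᗮ.orthogonalProjectionOnto ∘L B ∘L Nᗮ.subtypeL := by
      ext x
      have hx : Q (x : H) = x := Submodule.starProjection_eq_self_iff.mpr x.2
      change Q (Q (B (Q (x : H)))) = Q (B x)
      rw [hx]
      exact Submodule.starProjection_eq_self_iff.mpr (Submodule.starProjection_apply_mem _ _)
    rw [← e]
    exact h.comp_contractions _ _ hP hI
  refine ⟨?_, fun h => h.comp_contractions _ _ hP hI⟩
  tfae_have 1 ↔ 2 := ⟨h12, h21⟩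
  tfae_have 2 ↔ 4 := by rw [← hsq]; exact KreinVN.memTraceIdeal_adjoint_comp_self_iff
  tfae_have 4 → 3 := fun h => hadj ▸ h.adjoint
  tfae_have 3 → 4 := fun h => by
    simpa only [← hadj, ContinuousLinearMap.adjoint_adjoint] using h.adjoint
  tfae_finish
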